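/- Let $\Omega\subset\mathbb R^n$ be a Borel set and let $F\subset\overline{\Omega}$ be closed with $\lambda(F\cap\Omega)=0$, where $\lambda$ is Lebesgue measure; for $\delta>0$ let $F_\delta$ be the open $\delta$-neighbourhood of $F$ in $\mathbb R^n$. A \emph{density measure} for $F$ is a bounded, finitely additive set function $\mu\ge 0$ on the Borel subsets of $\Omega$ such that $\mu(A)=0$ for every Borel set $A\subset\Omega$ with $\lambda(A)=0$, and $\mu(F_\delta\cap\Omega)=\mu(\Omega)=1$ for all $\delta>0$; $\mathrm{Dens}(F)$ denotes the set of all of them. Integrals with respect to a bounded finitely additive $\mu$ are taken in the usual sense: $f$ is integrable if there are simple functions $s_k$ converging to $f$ in measure (with respect to the outer measure of $|\mu|$) with $\int|s_k-s_l|\,d|\mu|\to0$ as $k,l\to\infty$, and then $\int f\,d\mu=\lim_k\int s_k\,d\mu$. Let $f\in L^\infty(\Omega,\lambda)$. (1) For every $\mu\in\mathrm{Dens}(F)$, $f$ is $\mu$-integrable over $F_\delta\cap\Omega$ for all $\delta>0$, the value $\int_F f\,d\mu:=\int_{F_\delta\cap\Omega}f\,d\mu$ does not depend on $\delta>0$,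 and $$\lim_{\delta\downarrow0}\operatorname*{ess\,inf}_{F_\delta\cap\Omega}f\;\le\;\int_F f\,d\mu\;\le\;\lim_{\delta\downarrow0}\operatorname*{ess\,sup}_{F_\delta\cap\Omega}f,$$ where both limits exist and are finite. (2) If $F\neq\emptyset$ and $\lambda(F_\delta\cap\Omega)>0$ for every $\delta>0$, then both limits exist and are finite, and $$\sup_{\mu\in\mathrm{Dens}(F)}\int_F f\,d\mu=\lim_{\delta\downarrow0}\operatorname*{ess\,sup}_{F_\delta\cap\Omega}f,\qquad \inf_{\mu\in\mathrm{Dens}(F)}\int_F f\,d\mu=\lim_{\delta\downarrow0}\operatorname*{ess\,inf}_{F_\delta\cap\Omega}f,$$ where the supremum and infimum are over a non-empty set. -/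

import Mathlib

open MeasureTheory Filter Topology
open scoped ENNReal

namespace FinAdd

section General

variable {X : Type*} [MeasurableSpace X]

/-- Real-valued finitely additive set functions on the measurable subsets of `X`
("measures" in the terminology of finitely additive measure theory).
Values at non-measurable sets are irrelevant and are never used. -/
abbrev FAMeasure (X : Type*) [MeasurableSpace X] : Type _ :=
  AddContent ℝ {A : Set X | MeasurableSet A}

/-- `μ` is bounded: `sup |μ(A)| < ∞` over all measurable `A`. -/
def IsBoundedFA (μ : FAMeasure X) : Prop :=
  ∃ C : ℝ, ∀ A : Set X, MeasurableSet A → |μ A| ≤ C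

/-- `μ ≥ 0`. -/
def IsNonnegFA (μ : FAMeasure X) : Prop :=
  ∀ A : Set X, MeasurableSet A → 0 ≤ μ A

/-- `μ` is weakly absolutely continuous with respect to the (`σ`-additive, positive) measure `ν`:
`ν(A) = 0` implies `μ(A) = 0`, for all measurable `A`. -/
def IsWeaklyAC (μ : FAMeasure X) (ν : Measure X) : Prop :=
  ∀ A : Set X, MeasurableSet A → ν A = 0 → μ A = 0

/-- The positive part `μ⁺(A) = sup {μ(B) : B ⊆ A measurable}` of a bounded `μ`. -/
noncomputable def posVar (μ : FAMeasure X) (A : Set X) : ℝ :=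
  sSup {r : ℝ | ∃ B : Set X, MeasurableSet B ∧ B ⊆ A ∧ r = μ B}

/-- The negative part `μ⁻(A) = (-μ)⁺(A) = sup {-μ(B) : B ⊆ A measurable}` of a bounded `μ`. -/
noncomputable def negVar (μ : FAMeasure X) (A : Set X) : ℝ :=
  sSup {r : ℝ | ∃ B : Set X, MeasurableSet B ∧ B ⊆ A ∧ r = -μ B}

/-- The total variation `|μ| = μ⁺ + μ⁻` of a bounded `μ`. -/
noncomputable def totVar (μ : FAMeasure X) (A : Set X) : ℝ :=
  posVar μ A + negVar μ A

/-- The outer measure `|μ|^*(B) = inf {|μ|(A) : B ⊆ A measurable}`, for arbitrary `B`. -/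
noncomputable def outerVar (μ : FAMeasure X) (B : Set X) : ℝ :=
  sInf {r : ℝ | ∃ A : Set X, MeasurableSet A ∧ B ⊆ A ∧ r = totVar μ A}

/-- Convergence in measure: `|μ|^*({x : |f_k(x) - f(x)| > ε}) → 0` for every `ε > 0`. -/
def ConvInMeasure (μ : FAMeasure X) (fk : ℕ → X → ℝ) (f : X → ℝ) : Prop :=
  ∀ ε : ℝ, 0 < ε →
    Tendsto (fun k : ℕ => outerVar μ {x : X | ε < |fk k x - f x|}) atTop (𝓝 0)

/-- The integral `∑ y, y * m({s = y})` of a simple function `s` against a set function `m`. -/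
noncomputable def simpleIntegral (m : Set X → ℝ) (s : SimpleFunc X ℝ) : ℝ :=
  ∑ y ∈ s.range, y * m (s ⁻¹' {y})

/-- `(s_k)` is a determining sequence for the integral of `f` with respect to `μ`: a sequence of
simple functions converging to `f` in measure with `∫ |s_k - s_l| d|μ| → 0` as `k, l → ∞`. -/
def IsDetermining (μ : FAMeasure X) (f : X → ℝ) (s : ℕ → SimpleFunc X ℝ) : Prop :=
  ConvInMeasure μ (fun k x => s k x) f ∧
    Tendsto (fun p : ℕ × ℕ => simpleIntegral (totVar μ) ((s p.1 - s p.2).map (fun y : ℝ => |y|)))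
      atTop (𝓝 0)

/-- `I` is the limit of `∫ s_k dμ` for some determining sequence `(s_k)` of `f`. -/
def HasFAIntegral (μ : FAMeasure X) (f : X → ℝ) (I : ℝ) : Prop :=
  ∃ s : ℕ → SimpleFunc X ℝ, IsDetermining μ f s ∧
    Tendsto (fun k : ℕ => simpleIntegral (fun A => μ A) (s k)) atTop (𝓝 I)

/-- `f` is integrable with respect to `μ`: it has a determining sequence. -/
def FAIntegrable (μ : FAMeasure X) (f : X → ℝ) : Prop :=
  ∃ s : ℕ → SimpleFunc X ℝ, IsDetermining μ f s

open Classical in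
/-- The integral `∫ f dμ` (with the value `0` if there is none). -/
noncomputable def faIntegral (μ : FAMeasure X) (f : X → ℝ) : ℝ :=
  if h : ∃ I : ℝ, HasFAIntegral μ f I then h.choose else 0

/-- The integral `∫_A f dμ` over a subset `A`. -/
noncomputable def faSetIntegral (μ : FAMeasure X) (A : Set X) (f : X → ℝ) : ℝ :=
  faIntegral μ (A.indicator f)

end General

section Density

variable {n : ℕ}

/-- Lebesgue measure on (the Borel subsets of) a Borel set `Ω ⊆ ℝⁿ`. -/
noncomputable def lebesgueOn (Ω : Set (EuclideanSpace ℝ (Fin n))) : Measure Ω :=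
  (volume : Measure (EuclideanSpace ℝ (Fin n))).comap Subtype.val

/-- `F_δ ∩ Ω` as a subset of `Ω`, where `F_δ` is the open `δ`-neighbourhood of `F` in `ℝⁿ`. -/
def nhdIn (Ω F : Set (EuclideanSpace ℝ (Fin n))) (δ : ℝ) : Set Ω :=
  Subtype.val ⁻¹' Metric.thickening δ F

/-- The density measures for `F`: the bounded, finitely additive `μ ≥ 0` on the Borel subsets of
`Ω` that are weakly absolutely continuous with respect to Lebesgue measure and satisfy
`μ(F_δ ∩ Ω) = μ(Ω) = 1` for all `δ > 0`. -/
def DensityMeasures (Ω F : Set (EuclideanSpace ℝ (Fin n))) : Set (FAMeasure Ω) :=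
  {μ | IsBoundedFA μ ∧ IsWeaklyAC μ (lebesgueOn Ω) ∧ IsNonnegFA μ ∧
    μ Set.univ = 1 ∧ ∀ δ : ℝ, 0 < δ → μ (nhdIn Ω F δ) = 1}

/-- The integral `∫_F f dμ := ∫_{F_δ ∩ Ω} f dμ`. For `μ` concentrated near `F` it does not depend
on `δ > 0`; the definition takes `δ = 1`. -/
noncomputable def coreIntegral (Ω F : Set (EuclideanSpace ℝ (Fin n))) (μ : FAMeasure Ω)
    (f : Ω → ℝ) : ℝ :=
  faSetIntegral μ (nhdIn Ω F 1) f

/-- The essential supremum of `f` over `F_δ ∩ Ω` with respect to Lebesgue measure. -/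
noncomputable def essSupNear (Ω F : Set (EuclideanSpace ℝ (Fin n))) (f : Ω → ℝ) (δ : ℝ) : ℝ :=
  essSup f ((lebesgueOn Ω).restrict (nhdIn Ω F δ))

/-- The essential infimum of `f` over `F_δ ∩ Ω` with respect to Lebesgue measure. -/
noncomputable def essInfNear (Ω F : Set (EuclideanSpace ℝ (Fin n))) (f : Ω → ℝ) (δ : ℝ) : ℝ :=
  essInf f ((lebesgueOn Ω).restrict (nhdIn Ω F δ))

end Density

end FinAdd

/-! For `μ ≥ 0` the integral is monotone up to `μ`-null sets (`HasFAIntegral.mono`), whatever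
determining sequences are used. This one fact gives uniqueness of the integral, independence of `δ`
(shells between neighbourhoods are `μ`-null) and the bound by the essential supremum near `F`
(`coreIntegral_le_essSupNear`). Integrability holds because bounded measurable functions are uniform
limits of simple ones.

The bound `M = lim ess sup` is attained: `M` is a cluster point of `f` along the filter `aeNear`
(`mapClusterPt_aeNear`), so some ultrafilter `U` finer than `aeNear` has `f → M`. Its `0`-`1`
measure is a density measure, and its integral of `f` is `M`. Infima follow by passing to `-f`. -/

namespace FinAdd

/-! ### Nonnegative finitely additive set functions and their variation -/

section Basic

variable {X : Type*} [MeasurableSpace X] {μ : FAMeasure X}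

lemma apply_union (μ : FAMeasure X) {A B : Set X} (hA : MeasurableSet A) (hB : MeasurableSet B)
    (h : Disjoint A B) : μ (A ∪ B) = μ A + μ B :=
  addContent_union' hA hB (hA.union hB) h

lemma apply_add_diff (μ : FAMeasure X) {A B : Set X} (hA : MeasurableSet A) (hB : MeasurableSet B)
    (h : A ⊆ B) : μ B = μ A + μ (B \ A) := by
  rw [← apply_union μ hA (hB.diff hA) Set.disjoint_sdiff_right, Set.union_sdiff_cancel h]

lemma IsNonnegFA.mono (hμ : IsNonnegFA μ) {A B : Set X} (hA : MeasurableSet A)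
    (hB : MeasurableSet B) (h : A ⊆ B) : μ A ≤ μ B := by
  rw [apply_add_diff μ hA hB h]
  linarith [hμ _ (hB.diff hA)]

lemma IsNonnegFA.union_le (hμ : IsNonnegFA μ) {A B : Set X} (hA : MeasurableSet A)
    (hB : MeasurableSet B) : μ (A ∪ B) ≤ μ A + μ B := by
  rw [← Set.union_sdiff_self, apply_union μ hA (hB.diff hA) Set.disjoint_sdiff_right]
  linarith [hμ.mono (hB.diff hA) hB Set.sdiff_subset]

/-- By monotonicity the supremum for `μ⁺` is attained at `A` itself and that for `μ⁻` at `∅`. -/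
lemma IsNonnegFA.totVar_eq (hμ : IsNonnegFA μ) {A : Set X} (hA : MeasurableSet A) :
    totVar μ A = μ A := by
  have hpos : posVar μ A = μ A := IsGreatest.csSup_eq
    ⟨⟨A, hA, subset_rfl, rfl⟩, by rintro r ⟨B, hB, hBA, rfl⟩; exact hμ.mono hB hA hBA⟩
  have hneg : negVar μ A = 0 := IsGreatest.csSup_eq
    ⟨⟨∅, MeasurableSet.empty, Set.empty_subset _, by simp⟩, by
      rintro r ⟨B, hB, -, rfl⟩; linarith [hμ B hB]⟩
  rw [totVar, hpos, hneg, add_zero]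

lemma IsNonnegFA.outerVar_nonneg (hμ : IsNonnegFA μ) (B : Set X) : 0 ≤ outerVar μ B :=
  Real.sInf_nonneg (by rintro r ⟨A, hA, -, rfl⟩; rw [hμ.totVar_eq hA]; exact hμ A hA)

lemma IsNonnegFA.outerVar_le (hμ : IsNonnegFA μ) {A B : Set X} (hA : MeasurableSet A)
    (h : B ⊆ A) : outerVar μ B ≤ μ A :=
  csInf_le ⟨0, by rintro r ⟨A, hA, -, rfl⟩; rw [hμ.totVar_eq hA]; exact hμ A hA⟩
    ⟨A, hA, h, (hμ.totVar_eq hA).symm⟩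

lemma IsNonnegFA.exists_of_outerVar_lt (hμ : IsNonnegFA μ) {B : Set X} {ε : ℝ}
    (h : outerVar μ B < ε) : ∃ A, MeasurableSet A ∧ B ⊆ A ∧ μ A < ε := by
  obtain ⟨r, ⟨A, hA, hBA, rfl⟩, hr⟩ :=
    exists_lt_of_csInf_lt
      (s := {r : ℝ | ∃ A : Set X, MeasurableSet A ∧ B ⊆ A ∧ r = totVar μ A})
      ⟨_, Set.univ, MeasurableSet.univ, Set.subset_univ _, rfl⟩ h
  exact ⟨A, hA, hBA, by rwa [← hμ.totVar_eq hA]⟩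

end Basic

/-! ### Integrals of simple functions -/

section SimpleIntegral

variable {X : Type*} [MeasurableSpace X] {μ : FAMeasure X}

lemma simpleIntegral_eq_setToSimpleFunc (m : Set X → ℝ) (s : SimpleFunc X ℝ) :
    simpleIntegral m s =
      s.setToSimpleFunc (fun A => m A • ContinuousLinearMap.id ℝ ℝ) := by
  simp [simpleIntegral, SimpleFunc.setToSimpleFunc, mul_comm]

/-- With the zero measure as reference every simple function is integrable, so the `setToSimpleFunc`
lemmas apply without side conditions. -/
lemma finMeasAdditive_smul_id (μ : FAMeasure X) :
    FinMeasAdditive (0 : Measure X) (fun A => μ A • ContinuousLinearMap.id ℝ ℝ) := by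
  intro A B hA hB _ _ h
  simp only [apply_union μ hA hB h, add_smul]

lemma simpleIntegral_add (μ : FAMeasure X) (s t : SimpleFunc X ℝ) :
    simpleIntegral μ (s + t) = simpleIntegral μ s + simpleIntegral μ t := by
  simp only [simpleIntegral_eq_setToSimpleFunc]
  exact SimpleFunc.setToSimpleFunc_add _ (finMeasAdditive_smul_id μ) integrable_zero_measure
    integrable_zero_measure

lemma simpleIntegral_neg (μ : FAMeasure X) (s : SimpleFunc X ℝ) :
    simpleIntegral μ (-s) = -simpleIntegral μ s := by
  simp only [simpleIntegral_eq_setToSimpleFunc]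
  exact SimpleFunc.setToSimpleFunc_neg _ (finMeasAdditive_smul_id μ) integrable_zero_measure

lemma simpleIntegral_sub (μ : FAMeasure X) (s t : SimpleFunc X ℝ) :
    simpleIntegral μ (s - t) = simpleIntegral μ s - simpleIntegral μ t := by
  rw [sub_eq_add_neg, simpleIntegral_add, simpleIntegral_neg, sub_eq_add_neg]

lemma IsNonnegFA.simpleIntegral_mono (hμ : IsNonnegFA μ) {s t : SimpleFunc X ℝ} (h : s ≤ t) :
    simpleIntegral μ s ≤ simpleIntegral μ t := by
  simp only [simpleIntegral_eq_setToSimpleFunc]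
  refine SimpleFunc.setToSimpleFunc_mono (finMeasAdditive_smul_id μ) (fun A hA _ x hx => ?_)
    integrable_zero_measure integrable_zero_measure h
  simpa using mul_nonneg (hμ A hA) hx

/-- The simple function with value `c` on `A` and `0` elsewhere. -/
noncomputable def simpleIndicator (A : Set X) (hA : MeasurableSet A) (c : ℝ) : SimpleFunc X ℝ :=
  SimpleFunc.piecewise A hA (SimpleFunc.const X c) (SimpleFunc.const X 0)

lemma simpleIndicator_apply (A : Set X) (hA : MeasurableSet A) (c : ℝ) (x : X) :
    simpleIndicator A hA c x = A.indicator (fun _ => c) x := by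
  classical
  simp [simpleIndicator, SimpleFunc.piecewise_apply, Set.indicator_apply]

lemma simpleIntegral_simpleIndicator (μ : FAMeasure X) {A : Set X} (hA : MeasurableSet A) (c : ℝ) :
    simpleIntegral μ (simpleIndicator A hA c) = c * μ A := by
  rw [simpleIntegral_eq_setToSimpleFunc, simpleIndicator, SimpleFunc.setToSimpleFunc_indicator]
  · simp [mul_comm]
  · simp

lemma simpleIntegral_const (μ : FAMeasure X) (c : ℝ) :
    simpleIntegral μ (SimpleFunc.const X c) = c * μ Set.univ := by
  rw [simpleIntegral_eq_setToSimpleFunc, SimpleFunc.setToSimpleFunc_const]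
  · simp [mul_comm]
  · simp

lemma IsNonnegFA.simpleIntegral_totVar (hμ : IsNonnegFA μ) (s : SimpleFunc X ℝ) :
    simpleIntegral (totVar μ) s = simpleIntegral μ s :=
  Finset.sum_congr rfl fun y _ => by rw [hμ.totVar_eq (s.measurableSet_preimage _)]

lemma IsNonnegFA.abs_simpleIntegral_sub_le (hμ : IsNonnegFA μ) (s t : SimpleFunc X ℝ) :
    |simpleIntegral μ s - simpleIntegral μ t| ≤
      simpleIntegral μ ((s - t).map (fun y : ℝ => |y|)) := by
  rw [← simpleIntegral_sub, abs_le, neg_le, ← simpleIntegral_neg]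
  exact ⟨hμ.simpleIntegral_mono fun x => neg_le_abs _, hμ.simpleIntegral_mono fun x => le_abs_self _⟩

lemma IsNonnegFA.simpleIntegral_abs_nonneg (hμ : IsNonnegFA μ) (s : SimpleFunc X ℝ) :
    0 ≤ simpleIntegral μ (s.map (fun y : ℝ => |y|)) := by
  have := hμ.simpleIntegral_mono (s := SimpleFunc.const X 0) (t := s.map (fun y : ℝ => |y|))
    fun x => abs_nonneg _
  rwa [simpleIntegral_const, zero_mul] at this

end SimpleIntegral

/-! ### The finitely additive integral -/

section Integral

variable {X : Type*} [MeasurableSpace X] {μ : FAMeasure X}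

lemma IsNonnegFA.eventually_exists_measurableSet (hμ : IsNonnegFA μ) {f : X → ℝ}
    {s : ℕ → SimpleFunc X ℝ} (hs : IsDetermining μ f s) {ε η : ℝ} (hε : 0 < ε) (hη : 0 < η) :
    ∀ᶠ k in atTop, ∃ A, MeasurableSet A ∧ μ A < η ∧ ∀ x ∉ A, |s k x - f x| ≤ ε := by
  filter_upwards [(hs.1 ε hε).eventually_lt_const hη] with k hk
  obtain ⟨A, hA, hsub, hlt⟩ := hμ.exists_of_outerVar_lt hk
  exact ⟨A, hA, hlt, fun x hx => not_lt.1 fun h => hx (hsub h)⟩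

/-- The integral is monotone, up to null sets, whatever determining sequences are used. -/
lemma HasFAIntegral.mono (hμ : IsNonnegFA μ) {f g : X → ℝ} {I J : ℝ} (hf : HasFAIntegral μ f I)
    (hg : HasFAIntegral μ g J) {N : Set X} (hN : MeasurableSet N) (hN0 : μ N = 0)
    (h : ∀ x ∉ N, f x ≤ g x) : I ≤ J := by
  obtain ⟨s, hs, hsI⟩ := hf
  obtain ⟨t, ht, htJ⟩ := hg
  have hlim := hsI.sub htJ
  simp only [← simpleIntegral_sub] at hlim
  have key : ∀ ε : ℝ, 0 < ε → I - J ≤ ε * (4 + 2 * μ Set.univ) := by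
    intro ε hε
    have h1 := hs.2.eventually_lt_const hε
    have h2 := ht.2.eventually_lt_const hε
    simp only [hμ.simpleIntegral_totVar] at h1 h2
    obtain ⟨K, hK⟩ := eventually_atTop_prod_self.1 (h1.and h2)
    -- The exceptional sets below vary with `k`, so the bound is taken at the frozen index `K`; `C +
    -- 1` keeps the divisor positive.
    obtain ⟨C, hC0, hC⟩ : ∃ C : ℝ, 0 ≤ C ∧ ∀ x, s K x - t K x ≤ C := by
      obtain ⟨C, hC⟩ := ((s K - t K).finite_range).bddAbove
      exact ⟨max C 0, le_max_right _ _, fun x => (hC ⟨x, rfl⟩).trans (le_max_left _ _)⟩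
    have hη : 0 < ε / (C + 1) := by positivity
    refine le_of_tendsto hlim ?_
    filter_upwards [eventually_ge_atTop K, hμ.eventually_exists_measurableSet hs hε hη,
      hμ.eventually_exists_measurableSet ht hε hη]
      with k hkK ⟨A, hA, hAη, hAs⟩ ⟨B, hB, hBη, hBt⟩
    have hE : MeasurableSet (A ∪ B ∪ N) := (hA.union hB).union hN
    have hμE : μ (A ∪ B ∪ N) ≤ 2 * (ε / (C + 1)) := by
      linarith [hμ.union_le (hA.union hB) hN, hμ.union_le hA hB]
    have hCE : C * μ (A ∪ B ∪ N) ≤ 2 * ε := by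
      calc C * μ (A ∪ B ∪ N) ≤ (C + 1) * (2 * (ε / (C + 1))) := by
            gcongr
            · exact hμ _ hE
            · linarith
        _ = 2 * ε := by field_simp
    -- On the exceptional set, compare with `s K - t K ≤ C`; off it, `s k ≤ f + ε ≤ g + ε ≤ t k +
    -- 2ε`.
    have hle : s k - t k ≤ (s k - s K).map (fun y : ℝ => |y|) + (t k - t K).map (fun y : ℝ => |y|)
        + simpleIndicator (A ∪ B ∪ N) hE C + SimpleFunc.const X (2 * ε) := by
      intro x
      simp only [SimpleFunc.coe_add, SimpleFunc.coe_sub, SimpleFunc.map_apply, Pi.add_apply,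
        Pi.sub_apply, SimpleFunc.const_apply, simpleIndicator_apply]
      by_cases hx : x ∈ A ∪ B ∪ N
      · rw [Set.indicator_of_mem hx]
        linarith [le_abs_self (s k x - s K x), neg_le_abs (t k x - t K x), hC x]
      · rw [Set.indicator_of_notMem hx]
        simp only [Set.mem_union, not_or] at hx
        linarith [abs_nonneg (s k x - s K x), abs_nonneg (t k x - t K x), h x hx.2,
          (abs_le.1 (hAs x hx.1.1)).2, (abs_le.1 (hBt x hx.1.2)).1]
    have hint := hμ.simpleIntegral_mono hle
    simp only [simpleIntegral_add, simpleIntegral_simpleIndicator, simpleIntegral_const] at hint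
    have := hK k K hkK le_rfl
    linarith [this.1, this.2]
  have hlim0 : Tendsto (fun ε : ℝ => ε * (4 + 2 * μ Set.univ)) (𝓝[>] 0) (𝓝 0) := by
    have : Tendsto (fun ε : ℝ => ε) (𝓝[>] 0) (𝓝 0) := tendsto_id.mono_left nhdsWithin_le_nhds
    simpa using this.mul_const (4 + 2 * μ Set.univ)
  exact sub_nonpos.1 (ge_of_tendsto hlim0 (eventually_mem_nhdsWithin.mono key))

lemma IsNonnegFA.hasFAIntegral_unique (hμ : IsNonnegFA μ) {f : X → ℝ} {I J : ℝ}
    (hI : HasFAIntegral μ f I) (hJ : HasFAIntegral μ f J) : I = J :=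
  le_antisymm (hI.mono hμ hJ MeasurableSet.empty addContent_empty fun _ _ => le_rfl)
    (hJ.mono hμ hI MeasurableSet.empty addContent_empty fun _ _ => le_rfl)

lemma HasFAIntegral.faIntegral_eq (hμ : IsNonnegFA μ) {f : X → ℝ} {I : ℝ}
    (h : HasFAIntegral μ f I) : faIntegral μ f = I := by
  have hex : ∃ I : ℝ, HasFAIntegral μ f I := ⟨I, h⟩
  rw [faIntegral, dif_pos hex]
  exact hμ.hasFAIntegral_unique hex.choose_spec h

lemma FAIntegrable.hasFAIntegral (hμ : IsNonnegFA μ) {f : X → ℝ} (h : FAIntegrable μ f) :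
    HasFAIntegral μ f (faIntegral μ f) := by
  obtain ⟨s, hs⟩ := h
  have hc : CauchySeq fun k => simpleIntegral μ (s k) := by
    rw [cauchySeq_iff_tendsto_dist_atTop_0]
    have h2 := hs.2
    simp only [hμ.simpleIntegral_totVar] at h2
    exact squeeze_zero (fun _ => dist_nonneg)
      (fun p => hμ.abs_simpleIntegral_sub_le (s p.1) (s p.2)) h2
  obtain ⟨I, hI⟩ := cauchySeq_tendsto_of_complete hc
  have hfI : HasFAIntegral μ f I := ⟨s, hs, hI⟩
  rwa [hfI.faIntegral_eq hμ]

lemma outerVar_empty (hμ : IsNonnegFA μ) : outerVar μ ∅ = 0 :=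
  le_antisymm ((hμ.outerVar_le MeasurableSet.empty subset_rfl).trans_eq addContent_empty)
    (hμ.outerVar_nonneg _)

lemma IsNonnegFA.hasFAIntegral_simpleFunc (hμ : IsNonnegFA μ) (s : SimpleFunc X ℝ) :
    HasFAIntegral μ s (simpleIntegral μ s) := by
  refine ⟨fun _ => s, ⟨fun ε hε => ?_, ?_⟩, tendsto_const_nhds⟩
  · have : {x : X | ε < |s x - s x|} = ∅ := by
      ext x; simp [hε.le]
    simp only [this, outerVar_empty hμ, tendsto_const_nhds]
  · have h0 : (s - s).map (fun y : ℝ => |y|) = SimpleFunc.const X 0 := by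
      ext x; simp
    simp only [hμ.simpleIntegral_totVar, h0, simpleIntegral_const, zero_mul, tendsto_const_nhds]

lemma IsNonnegFA.hasFAIntegral_indicator_const (hμ : IsNonnegFA μ) {A : Set X}
    (hA : MeasurableSet A) (c : ℝ) : HasFAIntegral μ (A.indicator fun _ => c) (c * μ A) := by
  have h := hμ.hasFAIntegral_simpleFunc (simpleIndicator A hA c)
  rw [simpleIntegral_simpleIndicator] at h
  convert h using 1
  exact funext fun x => (simpleIndicator_apply A hA c x).symm

lemma HasFAIntegral.neg {f : X → ℝ} {I : ℝ} (h : HasFAIntegral μ f I) :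
    HasFAIntegral μ (fun x => -f x) (-I) := by
  obtain ⟨s, ⟨hs, hs'⟩, hI⟩ := h
  refine ⟨fun k => -s k, ⟨fun ε hε => ?_, ?_⟩, ?_⟩
  · convert hs ε hε using 5 with k x
    simp only [SimpleFunc.coe_neg, Pi.neg_apply]
    rw [neg_sub_neg, abs_sub_comm]
  · convert hs' using 3 with p
    ext x
    simp only [SimpleFunc.map_apply, SimpleFunc.coe_sub, SimpleFunc.coe_neg, Pi.sub_apply,
      Pi.neg_apply]
    rw [neg_sub_neg, abs_sub_comm]
  · simpa only [simpleIntegral_neg] using hI.neg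

/-- Bounded measurable functions are uniform limits of simple functions. -/
lemma exists_simpleFunc_abs_sub_le {g : X → ℝ} (hg : Measurable g) {C : ℝ} (hC : ∀ x, |g x| ≤ C)
    {ε : ℝ} (hε : 0 < ε) : ∃ s : SimpleFunc X ℝ, ∀ x, |s x - g x| ≤ ε := by
  -- Round `g` down to multiples of `ε`; boundedness leaves finitely many values.
  refine ⟨⟨fun x => ε * ⌊g x / ε⌋, fun y => ?_, ?_⟩, fun x => ?_⟩
  · exact (((measurable_from_top (f := fun z : ℤ => (z : ℝ))).comp
      (hg.div_const ε).floor).const_mul ε) (measurableSet_singleton y)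
  · refine ((Set.finite_Icc ⌊-C / ε⌋ ⌊C / ε⌋).image fun z : ℤ => ε * (z : ℝ)).subset ?_
    rintro _ ⟨x, rfl⟩
    have := abs_le.1 (hC x)
    exact ⟨⌊g x / ε⌋, ⟨Int.floor_mono (by gcongr; exact this.1),
      Int.floor_mono (by gcongr; exact this.2)⟩, rfl⟩
  · have h1 := Int.floor_le (g x / ε)
    have h2 := Int.lt_floor_add_one (g x / ε)
    rw [le_div_iff₀ hε] at h1
    rw [div_lt_iff₀ hε] at h2
    simp only [SimpleFunc.coe_mk]
    rw [abs_le]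
    constructor <;> linarith

lemma IsNonnegFA.faIntegrable_of_bounded (hμ : IsNonnegFA μ) {f g : X → ℝ} (hg : Measurable g)
    {C : ℝ} (hC : ∀ x, |g x| ≤ C) {N : Set X} (hN : MeasurableSet N) (hN0 : μ N = 0)
    (h : ∀ x ∉ N, f x = g x) : FAIntegrable μ f := by
  choose s hs using fun k : ℕ =>
    exists_simpleFunc_abs_sub_le hg hC (Nat.one_div_pos_of_nat (α := ℝ) (n := k))
  have hlim := tendsto_one_div_add_atTop_nhds_zero_nat (𝕜 := ℝ)
  refine ⟨s, fun ε hε => ?_, ?_⟩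
  · refine tendsto_const_nhds.congr' ?_
    filter_upwards [hlim.eventually_lt_const hε] with k hk
    refine le_antisymm (hμ.outerVar_nonneg _) ((hμ.outerVar_le hN fun x hx => ?_).trans_eq hN0)
    by_contra hxN
    have hx' : ε < |s k x - f x| := hx
    rw [h x hxN] at hx'
    linarith [hs k x]
  · simp only [hμ.simpleIntegral_totVar]
    have hlim2 : Tendsto (fun p : ℕ × ℕ =>
        (1 / ((p.1 : ℝ) + 1) + 1 / ((p.2 : ℝ) + 1)) * μ Set.univ) atTop (𝓝 0) := by
      rw [← prod_atTop_atTop_eq]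
      simpa using ((hlim.comp tendsto_fst).add (hlim.comp tendsto_snd)).mul_const (μ Set.univ)
    refine squeeze_zero (fun p => hμ.simpleIntegral_abs_nonneg _) (fun p => ?_) hlim2
    rw [← simpleIntegral_const]
    refine hμ.simpleIntegral_mono fun x => ?_
    simp only [SimpleFunc.map_apply, SimpleFunc.coe_sub, Pi.sub_apply, SimpleFunc.const_apply]
    have := abs_sub_le (s p.1 x) (g x) (s p.2 x)
    rw [abs_sub_comm (g x)] at this
    linarith [hs p.1 x, hs p.2 x]

end Integral

end FinAdd
namespace FinAdd

/-! ### Measures from ultrafilters -/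

section Ultrafilter

variable {X : Type*} [MeasurableSpace X]

open Classical in
/-- The `0`-`1`-valued finitely additive measure of an ultrafilter. -/
noncomputable def ofUltrafilter (U : Ultrafilter X) : FAMeasure X :=
  IsSetRing.addContent_of_union (fun A => if A ∈ U then 1 else 0)
    ⟨MeasurableSet.empty, fun _ _ hA hB => MeasurableSet.union hA hB,
      fun _ _ hA hB => MeasurableSet.diff hA hB⟩
    (by simp) fun {A B} _ _ h => by
      have hAB : A ∈ U → B ∉ U := fun hA hB =>
        U.empty_notMem (by simpa [h.inter_eq] using U.inter_sets hA hB)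
      by_cases hA : A ∈ U
      · simp [Ultrafilter.union_mem_iff, hA, hAB hA]
      · simp [Ultrafilter.union_mem_iff, hA]

open Classical in
lemma ofUltrafilter_apply (U : Ultrafilter X) (A : Set X) :
    ofUltrafilter U A = if A ∈ U then 1 else 0 := rfl

lemma ofUltrafilter_of_mem {U : Ultrafilter X} {A : Set X} (h : A ∈ U) : ofUltrafilter U A = 1 := by
  simp [ofUltrafilter_apply, h]

lemma ofUltrafilter_of_compl_mem {U : Ultrafilter X} {A : Set X} (h : Aᶜ ∈ U) :
    ofUltrafilter U A = 0 := by
  simp [ofUltrafilter_apply, Ultrafilter.compl_mem_iff_notMem.1 h]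

lemma isNonnegFA_ofUltrafilter (U : Ultrafilter X) : IsNonnegFA (ofUltrafilter U) := by
  intro A _
  rw [ofUltrafilter_apply]
  split_ifs <;> norm_num

lemma isBoundedFA_ofUltrafilter (U : Ultrafilter X) : IsBoundedFA (ofUltrafilter U) := by
  refine ⟨1, fun A _ => ?_⟩
  rw [ofUltrafilter_apply]
  split_ifs <;> norm_num

end Ultrafilter

/-! ### Weak absolute continuity and essentially bounded functions -/

section Null

variable {X : Type*} [MeasurableSpace X] {μ : FAMeasure X} {ν : Measure X}

lemma IsWeaklyAC.exists_null (hμ : IsWeaklyAC μ ν) {p : X → Prop} (hp : ∀ᵐ x ∂ν, p x) :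
    ∃ N, MeasurableSet N ∧ μ N = 0 ∧ ∀ x ∉ N, p x := by
  refine ⟨toMeasurable ν {x | ¬p x}, measurableSet_toMeasurable _ _, ?_, fun x hx => ?_⟩
  · exact hμ _ (measurableSet_toMeasurable _ _) (by rw [measure_toMeasurable]; exact hp)
  · by_contra h
    exact hx (subset_toMeasurable ν {x | ¬p x} h)

lemma exists_ae_abs_le {f : X → ℝ} (hf : MemLp f ∞ ν) : ∃ C : ℝ, ∀ᵐ x ∂ν, |f x| ≤ C := by
  refine ⟨(eLpNormEssSup f ν).toReal, ?_⟩
  have hfin : eLpNormEssSup f ν ≠ ∞ := by simpa using hf.2.ne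
  filter_upwards [ae_le_eLpNormEssSup (f := f) (μ := ν)] with x hx
  simpa using ENNReal.toReal_mono hfin hx

lemma IsWeaklyAC.faIntegrable_indicator (hμ : IsWeaklyAC μ ν) (hμ0 : IsNonnegFA μ) {f : X → ℝ}
    (hf : MemLp f ∞ ν) {A : Set X} (hA : MeasurableSet A) : FAIntegrable μ (A.indicator f) := by
  obtain ⟨C, hC⟩ := exists_ae_abs_le hf
  obtain ⟨N, hN, hN0, h⟩ := hμ.exists_null (hC.and hf.1.ae_eq_mk)
  -- Truncation turns the a.e. bound on the measurable representative into an everywhere bound;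
  -- `|C|` because the sign of `C` is unknown.
  have hg : Measurable (A.indicator fun x => max (-|C|) (min |C| (hf.1.mk f x))) :=
    (measurable_const.max (measurable_const.min hf.1.stronglyMeasurable_mk.measurable)).indicator hA
  refine hμ0.faIntegrable_of_bounded hg (C := |C|) (fun x => ?_) hN hN0 fun x hx => ?_
  · by_cases hxA : x ∈ A
    · rw [Set.indicator_of_mem hxA, abs_le]
      exact ⟨le_max_left _ _, max_le (by linarith [abs_nonneg C]) (min_le_left _ _)⟩
    · simp [Set.indicator_of_notMem hxA]
  · obtain ⟨h1, h2⟩ := h x hx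
    have h3 := abs_le.1 (h1.trans (le_abs_self C))
    by_cases hxA : x ∈ A
    · rw [Set.indicator_of_mem hxA, Set.indicator_of_mem hxA, ← h2, min_eq_right h3.2,
        max_eq_right h3.1]
    · simp [Set.indicator_of_notMem hxA]

end Null

/-! ### Density measures and essential bounds near `F` -/

section Density

variable {n : ℕ} {Ω F : Set (EuclideanSpace ℝ (Fin n))} {f : Ω → ℝ} {μ : FAMeasure Ω}

lemma measurableSet_nhdIn (Ω F : Set (EuclideanSpace ℝ (Fin n))) (δ : ℝ) :
    MeasurableSet (nhdIn Ω F δ) :=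
  measurable_subtype_coe Metric.isOpen_thickening.measurableSet

lemma nhdIn_mono (Ω F : Set (EuclideanSpace ℝ (Fin n))) {δ ε : ℝ} (h : δ ≤ ε) :
    nhdIn Ω F δ ⊆ nhdIn Ω F ε :=
  Set.preimage_mono (Metric.thickening_mono h F)

lemma lebesgueOn_nhdIn (hΩ : MeasurableSet Ω) (F : Set (EuclideanSpace ℝ (Fin n))) (δ : ℝ) :
    lebesgueOn Ω (nhdIn Ω F δ) = volume (Metric.thickening δ F ∩ Ω) := by
  rw [lebesgueOn, comap_subtype_coe_apply hΩ, nhdIn, Subtype.image_preimage_coe, Set.inter_comm]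

/-- The existence of a density measure already forces the positivity that the limits need. -/
lemma lebesgueOn_nhdIn_ne_zero (hμ : μ ∈ DensityMeasures Ω F) {δ : ℝ} (hδ : 0 < δ) :
    lebesgueOn Ω (nhdIn Ω F δ) ≠ 0 := fun h => by
  have h0 := hμ.2.1 _ (measurableSet_nhdIn Ω F δ) h
  rw [hμ.2.2.2.2 δ hδ] at h0
  exact one_ne_zero h0

lemma hasFAIntegral_nhdIn (hμ : μ ∈ DensityMeasures Ω F) (hf : MemLp f ∞ (lebesgueOn Ω)) (δ : ℝ) :
    HasFAIntegral μ ((nhdIn Ω F δ).indicator f) (faSetIntegral μ (nhdIn Ω F δ) f) :=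
  (hμ.2.1.faIntegrable_indicator hμ.2.2.1 hf (measurableSet_nhdIn Ω F δ)).hasFAIntegral hμ.2.2.1

lemma faSetIntegral_nhdIn_congr_of_le (hμ : μ ∈ DensityMeasures Ω F)
    (hf : MemLp f ∞ (lebesgueOn Ω)) {δ ε : ℝ} (hδ : 0 < δ) (h : δ ≤ ε) :
    faSetIntegral μ (nhdIn Ω F δ) f = faSetIntegral μ (nhdIn Ω F ε) f := by
  have hN := (measurableSet_nhdIn Ω F ε).diff (measurableSet_nhdIn Ω F δ)
  have hN0 : μ (nhdIn Ω F ε \ nhdIn Ω F δ) = 0 := by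
    have := apply_add_diff μ (measurableSet_nhdIn Ω F δ) (measurableSet_nhdIn Ω F ε)
      (nhdIn_mono Ω F h)
    rw [hμ.2.2.2.2 δ hδ, hμ.2.2.2.2 ε (hδ.trans_le h)] at this
    linarith
  have heq : ∀ x ∉ nhdIn Ω F ε \ nhdIn Ω F δ,
      (nhdIn Ω F δ).indicator f x = (nhdIn Ω F ε).indicator f x := by
    intro x hx
    by_cases hxδ : x ∈ nhdIn Ω F δ
    · rw [Set.indicator_of_mem hxδ, Set.indicator_of_mem (nhdIn_mono Ω F h hxδ)]
    · rw [Set.indicator_of_notMem hxδ, Set.indicator_of_notMem fun hxε => hx ⟨hxε, hxδ⟩]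
  have h1 := hasFAIntegral_nhdIn hμ hf δ
  have h2 := hasFAIntegral_nhdIn hμ hf ε
  exact le_antisymm (h1.mono hμ.2.2.1 h2 hN hN0 fun x hx => (heq x hx).le)
    (h2.mono hμ.2.2.1 h1 hN hN0 fun x hx => (heq x hx).ge)

lemma faSetIntegral_nhdIn_eq_coreIntegral (hμ : μ ∈ DensityMeasures Ω F)
    (hf : MemLp f ∞ (lebesgueOn Ω)) {δ : ℝ} (hδ : 0 < δ) :
    faSetIntegral μ (nhdIn Ω F δ) f = coreIntegral Ω F μ f := by
  rcases le_total δ 1 with h | h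
  · exact faSetIntegral_nhdIn_congr_of_le hμ hf hδ h
  · exact (faSetIntegral_nhdIn_congr_of_le hμ hf one_pos h).symm

lemma coreIntegral_neg (hμ : μ ∈ DensityMeasures Ω F) (hf : MemLp f ∞ (lebesgueOn Ω)) :
    coreIntegral Ω F μ (fun x => -f x) = -coreIntegral Ω F μ f := by
  have h := (hasFAIntegral_nhdIn hμ hf 1).neg
  refine HasFAIntegral.faIntegral_eq hμ.2.2.1 ?_
  have hneg : (nhdIn Ω F 1).indicator (fun x => -f x) = fun x => -(nhdIn Ω F 1).indicator f x :=
    Set.indicator_neg _ f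
  rwa [hneg]

lemma essInfNear_eq_neg (Ω F : Set (EuclideanSpace ℝ (Fin n))) (f : Ω → ℝ) (δ : ℝ) :
    essInfNear Ω F f δ = -essSupNear Ω F (fun x => -f x) δ := by
  rw [essInfNear, essSupNear, essInf, essSup, liminf_eq, limsup_eq, eq_neg_iff_add_eq_zero,
    add_comm, ← eq_neg_iff_add_eq_zero, ← Real.sInf_neg]
  congr 1
  ext a
  simp [neg_le]

lemma neBot_ae_restrict_nhdIn {δ : ℝ} (h : lebesgueOn Ω (nhdIn Ω F δ) ≠ 0) :
    (ae ((lebesgueOn Ω).restrict (nhdIn Ω F δ))).NeBot :=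
  ae_neBot.2 (by rwa [Ne, Measure.restrict_eq_zero])

lemma isBoundedUnder_le_ae {f : Ω → ℝ} (hf : MemLp f ∞ (lebesgueOn Ω)) (A : Set Ω) :
    IsBoundedUnder (· ≤ ·) (ae ((lebesgueOn Ω).restrict A)) f := by
  obtain ⟨C, hC⟩ := exists_ae_abs_le hf
  exact ⟨C, eventually_map.2 ((ae_restrict_of_ae hC).mono fun x hx => (abs_le.1 hx).2)⟩

lemma isBoundedUnder_ge_ae {f : Ω → ℝ} (hf : MemLp f ∞ (lebesgueOn Ω)) (A : Set Ω) :
    IsBoundedUnder (· ≥ ·) (ae ((lebesgueOn Ω).restrict A)) f := by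
  obtain ⟨C, hC⟩ := exists_ae_abs_le hf
  exact ⟨-C, eventually_map.2 ((ae_restrict_of_ae hC).mono fun x hx => (abs_le.1 hx).1)⟩

lemma ae_le_essSupNear (hf : MemLp f ∞ (lebesgueOn Ω)) (δ : ℝ) :
    ∀ᵐ x ∂(lebesgueOn Ω).restrict (nhdIn Ω F δ), f x ≤ essSupNear Ω F f δ :=
  ae_le_essSup (isBoundedUnder_le_ae hf _)

/-- Positivity makes the a.e. filter nontrivial, so the essential upper bounds are bounded below and
their real infimum is not a default value. -/
lemma essSupNear_le (hf : MemLp f ∞ (lebesgueOn Ω)) {δ : ℝ}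
    (hpos : lebesgueOn Ω (nhdIn Ω F δ) ≠ 0) {c : ℝ}
    (h : ∀ᵐ x ∂(lebesgueOn Ω).restrict (nhdIn Ω F δ), f x ≤ c) : essSupNear Ω F f δ ≤ c :=
  have := neBot_ae_restrict_nhdIn hpos
  essSup_le_of_ae_le c h (isBoundedUnder_ge_ae hf _).isCoboundedUnder_le

/-- Monotonicity in `δ` makes the limit an infimum over `δ > 0`. -/
lemma exists_tendsto_essSupNear (hf : MemLp f ∞ (lebesgueOn Ω))
    (hpos : ∀ δ : ℝ, 0 < δ → lebesgueOn Ω (nhdIn Ω F δ) ≠ 0) :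
    ∃ M : ℝ, Tendsto (essSupNear Ω F f) (𝓝[>] 0) (𝓝 M) ∧
      ∀ δ : ℝ, 0 < δ → M ≤ essSupNear Ω F f δ := by
  have hbdd : BddBelow (essSupNear Ω F f '' Set.Ioi 0) := by
    obtain ⟨C, hC⟩ := exists_ae_abs_le hf
    refine ⟨-C, ?_⟩
    rintro _ ⟨δ, hδ, rfl⟩
    have := neBot_ae_restrict_nhdIn (hpos δ hδ)
    obtain ⟨x, hx1, hx2⟩ :=
      ((ae_le_essSupNear (F := F) hf δ).and (ae_restrict_of_ae hC)).exists
    exact (abs_le.1 hx2).1.trans hx1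
  have hmono : MonotoneOn (essSupNear Ω F f) (Set.Ioi 0) := fun δ hδ ε _ h =>
    essSupNear_le hf (hpos δ hδ)
      (ae_mono (Measure.restrict_mono (nhdIn_mono Ω F h) le_rfl) (ae_le_essSupNear hf ε))
  exact ⟨_, hmono.tendsto_nhdsGT hbdd, fun δ hδ => csInf_le hbdd ⟨δ, hδ, rfl⟩⟩

lemma coreIntegral_le_essSupNear (hμ : μ ∈ DensityMeasures Ω F) (hf : MemLp f ∞ (lebesgueOn Ω))
    {δ : ℝ} (hδ : 0 < δ) : coreIntegral Ω F μ f ≤ essSupNear Ω F f δ := by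
  have hA := measurableSet_nhdIn Ω F δ
  obtain ⟨N, hN, hN0, h⟩ := hμ.2.1.exists_null
    ((ae_restrict_iff' hA).1 (ae_le_essSupNear (F := F) hf δ))
  have hc := hμ.2.2.1.hasFAIntegral_indicator_const hA (essSupNear Ω F f δ)
  rw [hμ.2.2.2.2 δ hδ, mul_one] at hc
  rw [← faSetIntegral_nhdIn_eq_coreIntegral hμ hf hδ]
  exact (hasFAIntegral_nhdIn hμ hf δ).mono hμ.2.2.1 hc hN hN0 fun x hx =>
    Set.indicator_le_indicator' (h x hx)

lemma coreIntegral_le_of_tendsto (hμ : μ ∈ DensityMeasures Ω F) (hf : MemLp f ∞ (lebesgueOn Ω))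
    {M : ℝ} (hM : Tendsto (essSupNear Ω F f) (𝓝[>] 0) (𝓝 M)) : coreIntegral Ω F μ f ≤ M :=
  ge_of_tendsto hM (eventually_mem_nhdsWithin.mono fun _ hδ => coreIntegral_le_essSupNear hμ hf hδ)

/-- The filter of almost everywhere convergence on the neighbourhoods of `F`. -/
noncomputable def aeNear (Ω F : Set (EuclideanSpace ℝ (Fin n))) : Filter Ω :=
  ⨅ δ ∈ Set.Ioi (0 : ℝ), ae ((lebesgueOn Ω).restrict (nhdIn Ω F δ))

lemma mem_aeNear {A : Set Ω} : A ∈ aeNear Ω F ↔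
    ∃ δ : ℝ, 0 < δ ∧ A ∈ ae ((lebesgueOn Ω).restrict (nhdIn Ω F δ)) := by
  refine mem_biInf_of_directed (fun δ hδ ε hε => ⟨min δ ε, lt_min hδ hε, ?_, ?_⟩) ⟨1, one_pos⟩
  · exact ae_mono (Measure.restrict_mono (nhdIn_mono Ω F (min_le_left _ _)) le_rfl)
  · exact ae_mono (Measure.restrict_mono (nhdIn_mono Ω F (min_le_right _ _)) le_rfl)

lemma ofUltrafilter_mem_densityMeasures {U : Ultrafilter Ω} (hU : ↑U ≤ aeNear Ω F) :
    ofUltrafilter U ∈ DensityMeasures Ω F := by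
  refine ⟨isBoundedFA_ofUltrafilter U, fun A hA hA0 => ofUltrafilter_of_compl_mem (hU ?_),
    isNonnegFA_ofUltrafilter U, ofUltrafilter_of_mem univ_mem,
    fun δ hδ => ofUltrafilter_of_mem (hU ?_)⟩
  · exact mem_aeNear.2 ⟨1, one_pos, ae_mono Measure.restrict_le_self (compl_mem_ae_iff.2 hA0)⟩
  · exact mem_aeNear.2 ⟨δ, hδ, ae_restrict_mem (measurableSet_nhdIn Ω F δ)⟩

lemma mapClusterPt_aeNear (hf : MemLp f ∞ (lebesgueOn Ω))
    (hpos : ∀ δ : ℝ, 0 < δ → lebesgueOn Ω (nhdIn Ω F δ) ≠ 0) {M : ℝ}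
    (hM : Tendsto (essSupNear Ω F f) (𝓝[>] 0) (𝓝 M))
    (hle : ∀ δ : ℝ, 0 < δ → M ≤ essSupNear Ω F f δ) : MapClusterPt M (aeNear Ω F) f := by
  rw [mapClusterPt_iff_frequently]
  intro s hs
  obtain ⟨ε, hε, hball⟩ := Metric.mem_nhds_iff.1 hs
  intro hev
  obtain ⟨δ, hδ, hδs⟩ := mem_aeNear.1 hev
  obtain ⟨η, hη, hηδ, hη0⟩ := ((hM.eventually_lt_const (lt_add_of_pos_right M hε)).and
    (Ioo_mem_nhdsGT hδ)).exists
  -- Near `F`, almost everywhere `f < M + ε` and `f` avoids the `ε`-ball at `M`, which leaves only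
  -- `f ≤ M - ε`.
  have hbound : essSupNear Ω F f η ≤ M - ε := by
    refine essSupNear_le hf (hpos η hηδ) ?_
    filter_upwards [ae_le_essSupNear (F := F) hf η,
      ae_mono (Measure.restrict_mono (nhdIn_mono Ω F hη0.le) le_rfl) hδs] with x hx1 hx2
    by_contra! hlt
    refine hx2 (hball ?_)
    rw [Metric.mem_ball, Real.dist_eq, abs_lt]
    constructor <;> linarith
  linarith [hle η hηδ]

lemma le_coreIntegral_ofUltrafilter (hf : MemLp f ∞ (lebesgueOn Ω)) {U : Ultrafilter Ω}
    (hU : ↑U ≤ aeNear Ω F) {M : ℝ} (hM : Tendsto f U (𝓝 M)) :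
    M ≤ coreIntegral Ω F (ofUltrafilter U) f := by
  have hμ := ofUltrafilter_mem_densityMeasures hU
  refine le_of_forall_lt fun c hc => ?_
  obtain ⟨d, hcd, hdM⟩ := exists_between hc
  refine hcd.trans_le ?_
  have hd := hμ.2.2.1.hasFAIntegral_indicator_const (measurableSet_nhdIn Ω F 1) d
  rw [hμ.2.2.2.2 1 one_pos, mul_one] at hd
  -- `{d ≤ f}` lies in `U` but may fail to be measurable; `U` contains all conull sets, so a
  -- measurable subset equal to it a.e. lies in `U` too.
  have hS : NullMeasurableSet {x | d ≤ f x} (lebesgueOn Ω) :=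
    nullMeasurableSet_le aemeasurable_const hf.1.aemeasurable
  obtain ⟨T, hTS, hT, hTeq⟩ := hS.exists_measurable_subset_ae_eq
  have hTU : T ∈ U := by
    have hae : ↑U ≤ ae (lebesgueOn Ω) := hU.trans fun A hA =>
      mem_aeNear.2 ⟨1, one_pos, ae_mono Measure.restrict_le_self hA⟩
    filter_upwards [hae hTeq, hM.eventually_const_le hdM] with x hx1 hx2
    exact hx1.mpr hx2
  refine hd.mono hμ.2.2.1 (hasFAIntegral_nhdIn hμ hf 1) hT.compl
    (ofUltrafilter_of_compl_mem (by rwa [compl_compl])) fun x hx => ?_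
  exact Set.indicator_le_indicator (hTS (not_not.1 hx))

lemma exists_isGreatest_coreIntegral (hf : MemLp f ∞ (lebesgueOn Ω))
    (hpos : ∀ δ : ℝ, 0 < δ → lebesgueOn Ω (nhdIn Ω F δ) ≠ 0) :
    ∃ M : ℝ, Tendsto (essSupNear Ω F f) (𝓝[>] 0) (𝓝 M) ∧
      IsGreatest ((fun μ => coreIntegral Ω F μ f) '' DensityMeasures Ω F) M := by
  obtain ⟨M, hM, hle⟩ := exists_tendsto_essSupNear hf hpos
  obtain ⟨U, hU, hUM⟩ := mapClusterPt_iff_ultrafilter.1 (mapClusterPt_aeNear hf hpos hM hle)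
  have hμ := ofUltrafilter_mem_densityMeasures hU
  refine ⟨M, hM, ⟨_, hμ, ?_⟩, ?_⟩
  · exact le_antisymm (coreIntegral_le_of_tendsto hμ hf hM)
      (le_coreIntegral_ofUltrafilter hf hU hUM)
  · rintro _ ⟨ν, hν, rfl⟩
    exact coreIntegral_le_of_tendsto hν hf hM

lemma exists_isLeast_coreIntegral (hf : MemLp f ∞ (lebesgueOn Ω))
    (hpos : ∀ δ : ℝ, 0 < δ → lebesgueOn Ω (nhdIn Ω F δ) ≠ 0) :
    ∃ m : ℝ, Tendsto (essInfNear Ω F f) (𝓝[>] 0) (𝓝 m) ∧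
      IsLeast ((fun μ => coreIntegral Ω F μ f) '' DensityMeasures Ω F) m := by
  obtain ⟨M, hM, ⟨μ, hμ, hμM⟩, hub⟩ := exists_isGreatest_coreIntegral hf.neg hpos
  refine ⟨-M, ?_, ⟨μ, hμ, ?_⟩, ?_⟩
  · exact hM.neg.congr fun δ => (essInfNear_eq_neg Ω F f δ).symm
  · exact neg_eq_iff_eq_neg.1 ((coreIntegral_neg hμ hf).symm.trans hμM)
  · rintro _ ⟨ν, hν, rfl⟩
    exact neg_le.1 ((coreIntegral_neg hν hf).symm.trans_le (hub ⟨ν, hν, rfl⟩))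

end Density

end FinAdd

theorem mainTheorem6 {n : ℕ} (Ω F : Set (EuclideanSpace ℝ (Fin n)))
    (hΩ : MeasurableSet Ω) (hFΩ : F ⊆ closure Ω) (hF : IsClosed F)
    (hnull : volume (F ∩ Ω) = 0)
    (f : Ω → ℝ) (hf : MemLp f ∞ (FinAdd.lebesgueOn Ω)) :
    (∀ μ ∈ FinAdd.DensityMeasures Ω F,
      (∀ δ : ℝ, 0 < δ →
        FinAdd.FAIntegrable μ ((FinAdd.nhdIn Ω F δ).indicator f) ∧
        FinAdd.faSetIntegral μ (FinAdd.nhdIn Ω F δ) f = FinAdd.coreIntegral Ω F μ f) ∧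
      ∃ m M : ℝ,
        Tendsto (FinAdd.essInfNear Ω F f) (𝓝[>] 0) (𝓝 m) ∧
        Tendsto (FinAdd.essSupNear Ω F f) (𝓝[>] 0) (𝓝 M) ∧
        m ≤ FinAdd.coreIntegral Ω F μ f ∧ FinAdd.coreIntegral Ω F μ f ≤ M) ∧
    (F.Nonempty →
      (∀ δ : ℝ, 0 < δ → 0 < volume (Metric.thickening δ F ∩ Ω)) →
      ∃ m M : ℝ,
        Tendsto (FinAdd.essSupNear Ω F f) (𝓝[>] 0) (𝓝 M) ∧
        IsLUB ((fun μ => FinAdd.coreIntegral Ω F μ f) '' FinAdd.DensityMeasures Ω F) M ∧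
        Tendsto (FinAdd.essInfNear Ω F f) (𝓝[>] 0) (𝓝 m) ∧
        IsGLB ((fun μ => FinAdd.coreIntegral Ω F μ f) '' FinAdd.DensityMeasures Ω F) m) := by
  refine ⟨fun μ hμ => ⟨fun δ hδ => ⟨hμ.2.1.faIntegrable_indicator hμ.2.2.1 hf
    (FinAdd.measurableSet_nhdIn Ω F δ), FinAdd.faSetIntegral_nhdIn_eq_coreIntegral hμ hf hδ⟩, ?_⟩,
    fun _ hpos => ?_⟩
  · have hpos : ∀ δ : ℝ, 0 < δ → FinAdd.lebesgueOn Ω (FinAdd.nhdIn Ω F δ) ≠ 0 :=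
      fun δ hδ => FinAdd.lebesgueOn_nhdIn_ne_zero hμ hδ
    obtain ⟨M, hM, hgr⟩ := FinAdd.exists_isGreatest_coreIntegral hf hpos
    obtain ⟨m, hm, hle⟩ := FinAdd.exists_isLeast_coreIntegral hf hpos
    exact ⟨m, M, hm, hM, hle.2 ⟨μ, hμ, rfl⟩, hgr.2 ⟨μ, hμ, rfl⟩⟩
  · have hpos' : ∀ δ : ℝ, 0 < δ → FinAdd.lebesgueOn Ω (FinAdd.nhdIn Ω F δ) ≠ 0 := fun δ hδ => by
      rw [FinAdd.lebesgueOn_nhdIn hΩ]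
      exact (hpos δ hδ).ne'
    obtain ⟨M, hM, hgr⟩ := FinAdd.exists_isGreatest_coreIntegral hf hpos'
    obtain ⟨m, hm, hle⟩ := FinAdd.exists_isLeast_coreIntegral hf hpos'
    exact ⟨m, M, hM, hgr.isLUB, hm, hle.isGLB⟩
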